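/- Let $G$ be a finitely generated group with one end. Then there is a finite symmetric generating set $S$ of $G$ with $1 \notin S$ such that the Cayley graph $\mathrm{Cay}(G,S)$ is not minor excluded; that is, for every $m \in \mathbb{N}$ the complete graph $K_m$ is a minor of $\mathrm{Cay}(G,S)$. Here $\mathrm{Cay}(G,S)$ is the graph with vertex set $G$ in which $u$ and $v$ are adjacent if and only if $u = sv$ for some $s \in S$. A finite graph $M$ is a minor of a graph $\Gamma$ if one can assign to each vertex $i$ of $M$ a nonempty finite connected subgraph $V_i$ of $\Gamma$, so that the $V_i$ are pairwise disjoint and for every edge $ij$ of $M$ there is an edge of $\Gamma$ between a vertex of $V_i$ and a vertex of $V_j$. The group $G$ has one end if, for a finite symmetric generating set $S_0 \not\ni 1$ of $G$ (equivalently, for every such set), the number of unbounded connected components of $\mathrm{Cay}(G,S_0) \smallsetminus B(n,1)$ converges to $1$ as $n \to \infty$, where $B(n,1)$ is the ball of radius $n$ centred at $1$ in $\mathrm{Cay}(G,S_0)$. -/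

import Mathlib

/-- `S` is a finite generating set of `G` in the sense used for Cayley graphs: it generates `G`
as a group, does not contain the identity, and is symmetric. -/
structure IsSymmGeneratingSet {G : Type*} [Group G] (S : Finset G) : Prop where
  closure_eq_top : Subgroup.closure (S : Set G) = ⊤
  one_notMem : (1 : G) ∉ S
  inv_mem : ∀ s ∈ S, s⁻¹ ∈ S

/-- The right-invariant Cayley graph `Cay(G, S)`: the vertices are the elements of `G`, and `uv`
is an edge iff `u = s v` for some `s ∈ S`. (`SimpleGraph.fromRel` removes loops and symmetrizes;
neither changes anything for symmetric `S` not containing `1`.) -/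
def rightCayleyGraph {G : Type*} [Group G] (S : Finset G) : SimpleGraph G :=
  SimpleGraph.fromRel (fun u v => ∃ s ∈ S, u = s * v)

/-- For a symmetric set not containing the identity, adjacency in the Cayley graph is literally
`u = s v` for some `s ∈ S`. -/
theorem rightCayleyGraph_adj {G : Type*} [Group G] {S : Finset G} (hS : IsSymmGeneratingSet S)
    (u v : G) : (rightCayleyGraph S).Adj u v ↔ ∃ s ∈ S, u = s * v := by
  rw [rightCayleyGraph, SimpleGraph.fromRel_adj]
  constructor
  · rintro ⟨-, h | ⟨s, hs, rfl⟩⟩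
    · exact h
    · exact ⟨s⁻¹, hS.inv_mem s hs, by simp⟩
  · rintro ⟨s, hs, rfl⟩
    refine ⟨fun h => hS.one_notMem ?_, Or.inl ⟨s, hs, rfl⟩⟩
    have h1 : s = 1 := by simpa using h
    exact h1 ▸ hs

/-- The (closed) ball of radius `n` around the vertex `O`, for the graph distance. -/
def graphBall {V : Type*} (Γ : SimpleGraph V) (O : V) (n : ℕ) : Set V :=
  {v | Γ.edist O v ≤ (n : ℕ∞)}

/-- The number of unbounded connected components of `Γ ∖ B(n, O)`. -/
noncomputable def numUnboundedComponents {V : Type*} (Γ : SimpleGraph V) (O : V) (n : ℕ) : ℕ∞ :=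
  Set.encard {C : Γ.ComponentCompl (graphBall Γ O n) | ∀ r : ℕ, ¬ C.supp ⊆ graphBall Γ O r}

/-- The connected, locally finite graph `Γ` with base vertex `O` has exactly `k` ends: the number
of unbounded connected components of `Γ ∖ B(n, O)` converges to `k` as `n → ∞`. -/
def HasNumberOfEnds {V : Type*} (Γ : SimpleGraph V) (O : V) (k : ℕ∞) : Prop :=
  Filter.Tendsto (fun n : ℕ => numUnboundedComponents Γ O n) Filter.atTop (nhds k)

/-- The finitely generated group `G` has one end: its Cayley graph with respect to a finite
generating set has one end (the choice of the finite generating set is immaterial). -/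
def IsOneEndedGroup (G : Type*) [Group G] : Prop :=
  ∃ S : Finset G, IsSymmGeneratingSet S ∧ HasNumberOfEnds (rightCayleyGraph S) 1 1

/-- The finite graph `M` is a minor of `Γ`: there are pairwise disjoint finite connected subgraphs
of `Γ` (the branch sets), one for each vertex of `M`, such that for every edge of `M` there is an
edge of `Γ` between the corresponding branch sets. -/
def IsGraphMinor {W V : Type*} (M : SimpleGraph W) (Γ : SimpleGraph V) : Prop :=
  ∃ B : W → Γ.Subgraph,
    (∀ i, (B i).verts.Finite ∧ (B i).Connected) ∧
    (∀ i j, i ≠ j → Disjoint (B i).verts (B j).verts) ∧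
    (∀ i j, M.Adj i j → ∃ u ∈ (B i).verts, ∃ v ∈ (B j).verts, Γ.Adj u v)

/-- `Γ` is minor excluded: some complete graph `K_m` is not a minor of `Γ`. -/
def MinorExcluded {V : Type*} (Γ : SimpleGraph V) : Prop :=
  ∃ m : ℕ, ¬ IsGraphMinor (SimpleGraph.completeGraph (Fin m)) Γ

/-! Fix a generating set `S` realising one-endedness and let `S'` be its punctured ball of radius 5.
Take `s ∈ S` and a maximal `N` disjoint from `s * N`. Both sets are coarsely dense, so inside
`Cay(G, S')` they act as two disjoint layers, which removes the planarity obstruction. One layer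
carries `m` disjoint rays, the other `m` disjoint connected annuli around `1`. Every ray meets the
shadow of every annulus, where a single edge joins the layers. Branch set `i` is an initial segment
of ray `i` together with annulus `i`; ray `i` is linked to annulus `j` for all `i`, `j`, which gives
`K_m`.

Annuli come from one-endedness (`exists_connected_annulus`). Rays come from Hall's theorem
(`exists_disjoint_rays`), whose counting condition follows from `exists_le_card_innerBoundary`: an
infinite connected set far from `1` has large boundary. -/

/-! ### Connected sets in a Cayley graph. -/

/-- Connectedness of a set of group elements in the Cayley graph, in terms of cuts: a part of `A`
that meets `A` and is closed under adjacency within `A` is all of `A`. -/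
def CayleyConnected {G : Type*} [Group G] (S : Finset G) (A : Set G) : Prop :=
  ∀ P : Set G, (∃ x ∈ A, x ∈ P) →
    (∀ x ∈ A, x ∈ P → ∀ y ∈ A, y * x⁻¹ ∈ S → y ∈ P) → A ⊆ P

theorem CayleyConnected.exists_crossing {G : Type*} [Group G] {S : Finset G} {A : Set G}
    (hA : CayleyConnected S A) {P : Set G} {u v : G} (hu : u ∈ A) (huP : u ∈ P) (hv : v ∈ A)
    (hvP : v ∉ P) : ∃ x ∈ A, x ∈ P ∧ ∃ y ∈ A, y ∉ P ∧ y * x⁻¹ ∈ S := by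
  by_contra! h
  refine hvP (hA P ⟨u, hu, huP⟩ (fun x hx hxP y hy hs => ?_) hv)
  by_contra hyP
  exact h x hx hxP y hy hyP hs

theorem CayleyConnected.union {G : Type*} [Group G] {S : Finset G}
    (hS : IsSymmGeneratingSet S) {A B : Set G} (hA : CayleyConnected S A)
    (hB : CayleyConnected S B) {a b : G} (ha : a ∈ A) (hb : b ∈ B) (hab : b * a⁻¹ ∈ S) :
    CayleyConnected S (A ∪ B) := by
  have hba : a * b⁻¹ ∈ S := by simpa using hS.inv_mem _ hab
  rintro P ⟨x, hx, hxP⟩ hP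
  have hAP : ∀ z ∈ A, z ∈ P → A ⊆ P := fun z hz hzP => hA P ⟨z, hz, hzP⟩
    fun x hx hxP y hy h => hP x (Or.inl hx) hxP y (Or.inl hy) h
  have hBP : ∀ z ∈ B, z ∈ P → B ⊆ P := fun z hz hzP => hB P ⟨z, hz, hzP⟩
    fun x hx hxP y hy h => hP x (Or.inr hx) hxP y (Or.inr hy) h
  rcases hx with hx | hx
  · have h := hAP x hx hxP
    exact Set.union_subset h (hBP b hb (hP a (Or.inl ha) (h ha) b (Or.inr hb) hab))
  · have h := hBP x hx hxP
    exact Set.union_subset (hAP a ha (hP b (Or.inr hb) (h hb) a (Or.inl ha) hba)) h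

theorem cayleyConnected_of_reachable {G : Type*} [Group G] {S : Finset G}
    (hS : IsSymmGeneratingSet S) {A : Set G}
    (h : ∀ x y : A, ((rightCayleyGraph S).induce A).Reachable x y) : CayleyConnected S A := by
  rintro P ⟨x, hx, hxP⟩ hP y hy
  obtain ⟨w⟩ := h ⟨x, hx⟩ ⟨y, hy⟩
  suffices H : ∀ (a b : A), ((rightCayleyGraph S).induce A).Walk a b → a.1 ∈ P → b.1 ∈ P from
    H _ _ w hxP
  intro a b w
  induction w with
  | nil => exact id
  | cons hadj _ ih =>
    intro ha
    refine ih (hP _ (Subtype.coe_prop _) ha _ (Subtype.coe_prop _) ?_)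
    obtain ⟨s, hs, e⟩ := (rightCayleyGraph_adj hS _ _).1
      (SimpleGraph.induce_adj.1 hadj).symm
    rw [e]; simpa using hs

theorem CayleyConnected.induce_connected {G : Type*} [Group G] {S : Finset G}
    (hS : IsSymmGeneratingSet S) {A : Set G} (hA : CayleyConnected S A) (hne : A.Nonempty) :
    ((rightCayleyGraph S).induce A).Connected := by
  have := hne.to_subtype
  refine ⟨fun x y => ?_⟩
  have h := hA {z | ∃ hz : z ∈ A, ((rightCayleyGraph S).induce A).Reachable x ⟨z, hz⟩}
    ⟨x, x.2, x.2, SimpleGraph.Reachable.refl _⟩ ?_ y.2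
  · exact h.2
  · rintro a - ⟨ha, har⟩ b hb hs
    refine ⟨hb, har.trans (SimpleGraph.Adj.reachable ?_)⟩
    rw [SimpleGraph.induce_adj]
    exact ((rightCayleyGraph_adj hS _ _).2 ⟨_, hs, by simp⟩).symm

theorem CayleyConnected.mul_right {G : Type*} [Group G] {S : Finset G} {A : Set G}
    (hA : CayleyConnected S A) (p : G) : CayleyConnected S {x | x * p⁻¹ ∈ A} := by
  rintro P ⟨x, hx, hxP⟩ hP y hy
  have h := hA {z | z * p ∈ P} ⟨x * p⁻¹, hx, by simpa using hxP⟩ ?_ hy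
  · simpa using h
  · intro a ha haP b hb hs
    exact hP (a * p) (by simpa using ha) haP (b * p) (by simpa using hb)
      (by simpa [mul_assoc] using hs)

theorem cayleyConnected_univ {G : Type*} [Group G] {S : Finset G}
    (hS : IsSymmGeneratingSet S) : CayleyConnected S (Set.univ : Set G) := by
  have hcl : Submonoid.closure (S : Set G) = ⊤ := by
    have e : (S : Set G) ∪ (S : Set G)⁻¹ = S := by
      refine Set.union_eq_left.2 fun s hs => ?_
      simpa using hS.inv_mem _ (Set.mem_inv.1 hs)
    rw [← e, ← Subgroup.closure_toSubmonoid, hS.closure_eq_top, Subgroup.top_toSubmonoid]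
  rintro P ⟨x, -, hxP⟩ hP y -
  suffices H : ∀ g ∈ Submonoid.closure (S : Set G), ∀ z ∈ P, g * z ∈ P by
    simpa using H (y * x⁻¹) (hcl ▸ Submonoid.mem_top _) x hxP
  intro g hg
  induction hg using Submonoid.closure_induction with
  | mem s hs => exact fun z hz => hP z trivial hz _ trivial (by simpa using hs)
  | one => simp
  | mul a b _ _ ha hb => intro z hz; rw [mul_assoc]; exact ha _ (hb _ hz)

theorem rightCayleyGraph_connected {G : Type*} [Group G] {S : Finset G}
    (hS : IsSymmGeneratingSet S) : (rightCayleyGraph S).Connected := by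
  have h := (cayleyConnected_univ hS).induce_connected hS Set.univ_nonempty
  exact (SimpleGraph.induceUnivIso _).connected_iff.1 h

/-! ### The word metric. -/

/-- Word length with respect to `S`. -/
noncomputable def wordLength {G : Type*} [Group G] (S : Finset G) (g : G) : ℕ :=
  (rightCayleyGraph S).dist 1 g

theorem mem_graphBall_iff {G : Type*} [Group G] {S : Finset G} (hS : IsSymmGeneratingSet S)
    (n : ℕ) (g : G) : g ∈ graphBall (rightCayleyGraph S) 1 n ↔ wordLength S g ≤ n := by
  rw [graphBall, Set.mem_ofPred_eq, wordLength,
    ← ((rightCayleyGraph_connected hS).preconnected 1 g).coe_dist_eq_edist]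
  exact Nat.cast_le

theorem wordLength_one {G : Type*} [Group G] (S : Finset G) : wordLength S 1 = 0 := by
  simp [wordLength]

/-- Edges come from left multiplication, so right translations are isometries; left ones need not
be. -/
theorem dist_eq_wordLength {G : Type*} [Group G] {S : Finset G} (hS : IsSymmGeneratingSet S)
    (u v : G) : (rightCayleyGraph S).dist u v = wordLength S (v * u⁻¹) := by
  have key : ∀ a b g : G, (rightCayleyGraph S).dist (a * g) (b * g) ≤
      (rightCayleyGraph S).dist a b := by
    intro a b g
    let f : rightCayleyGraph S →g rightCayleyGraph S :=
      ⟨fun x => x * g, fun {x y} h => by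
        obtain ⟨s, hs, e⟩ := (rightCayleyGraph_adj hS _ _).1 h
        exact (rightCayleyGraph_adj hS _ _).2 ⟨s, hs, by rw [e, mul_assoc]⟩⟩
    obtain ⟨w, hw⟩ := (rightCayleyGraph_connected hS).exists_walk_length_eq_dist a b
    rw [← hw, ← SimpleGraph.Walk.length_map f w]
    exact SimpleGraph.dist_le _
  refine le_antisymm ?_ ?_
  · simpa [wordLength] using key 1 (v * u⁻¹) u
  · simpa [wordLength] using key u v u⁻¹

theorem wordLength_mul_le {G : Type*} [Group G] {S : Finset G} (hS : IsSymmGeneratingSet S)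
    (a b : G) : wordLength S (a * b) ≤ wordLength S a + wordLength S b := by
  have h := (rightCayleyGraph_connected hS).dist_triangle (u := 1) (v := b) (w := a * b)
  rw [dist_eq_wordLength hS b] at h
  simp only [mul_inv_cancel_right] at h
  rw [add_comm]
  exact h

theorem wordLength_inv {G : Type*} [Group G] {S : Finset G} (hS : IsSymmGeneratingSet S)
    (a : G) : wordLength S a⁻¹ = wordLength S a := by
  have h := dist_eq_wordLength hS a 1
  rw [SimpleGraph.dist_comm] at h
  simpa [wordLength] using h.symm

theorem wordLength_eq_zero {G : Type*} [Group G] {S : Finset G} (hS : IsSymmGeneratingSet S)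
    {a : G} : wordLength S a = 0 ↔ a = 1 := by
  rw [wordLength, (rightCayleyGraph_connected hS).dist_eq_zero_iff, eq_comm]

theorem wordLength_eq_one {G : Type*} [Group G] {S : Finset G} (hS : IsSymmGeneratingSet S)
    {a : G} : wordLength S a = 1 ↔ a ∈ S := by
  rw [wordLength, SimpleGraph.dist_eq_one_iff_adj, SimpleGraph.adj_comm, rightCayleyGraph_adj hS]
  simp

theorem wordLength_le_of_mem {G : Type*} [Group G] {S : Finset G}
    (hS : IsSymmGeneratingSet S) {x y : G} (h : y * x⁻¹ ∈ S) :
    wordLength S y ≤ wordLength S x + 1 := by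
  have h1 := wordLength_mul_le hS (y * x⁻¹) x
  rw [(wordLength_eq_one hS).2 h] at h1
  simp only [inv_mul_cancel_right] at h1
  omega

theorem wordLength_sub_comm {G : Type*} [Group G] {S : Finset G}
    (hS : IsSymmGeneratingSet S) (x y : G) :
    wordLength S (y * x⁻¹) = wordLength S (x * y⁻¹) := by
  rw [← wordLength_inv hS]; simp

theorem wordLength_sub_triangle {G : Type*} [Group G] {S : Finset G}
    (hS : IsSymmGeneratingSet S) (x y z : G) :
    wordLength S (z * x⁻¹) ≤ wordLength S (y * x⁻¹) + wordLength S (z * y⁻¹) := by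
  have := wordLength_mul_le hS (z * y⁻¹) (y * x⁻¹)
  simp only [mul_assoc, inv_mul_cancel_left] at this ⊢
  omega

theorem wordLength_le_add_sub {G : Type*} [Group G] {S : Finset G}
    (hS : IsSymmGeneratingSet S) (x y : G) :
    wordLength S y ≤ wordLength S x + wordLength S (y * x⁻¹) := by
  simpa using wordLength_sub_triangle hS 1 x y

/-- Geodesics: an element of length `m + n` is a product of elements of lengths `m` and `n`. -/
theorem exists_mul_wordLength {G : Type*} [Group G] {S : Finset G} (hS : IsSymmGeneratingSet S)
    (m : ℕ) : ∀ (n : ℕ) (g : G), wordLength S g = m + n →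
      ∃ a b, g = a * b ∧ wordLength S a = m ∧ wordLength S b = n := by
  intro n g hg
  obtain ⟨w, hw⟩ := (rightCayleyGraph_connected hS).exists_walk_length_eq_dist 1 g
  change w.length = wordLength S g at hw
  have h1 : wordLength S (w.getVert n) ≤ n := by
    refine (SimpleGraph.dist_le (w.take n)).trans ?_
    simp [SimpleGraph.Walk.take_length]
  have h2 : wordLength S (g * (w.getVert n)⁻¹) ≤ m := by
    rw [← dist_eq_wordLength hS]
    refine (SimpleGraph.dist_le (w.drop n)).trans ?_
    simp only [SimpleGraph.Walk.drop_length]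
    omega
  have h3 := wordLength_le_add_sub hS (w.getVert n) g
  exact ⟨g * (w.getVert n)⁻¹, w.getVert n, by simp, by omega, by omega⟩

theorem finite_wordLength_le {G : Type*} [Group G] {S : Finset G} (hS : IsSymmGeneratingSet S)
    (n : ℕ) : {g : G | wordLength S g ≤ n}.Finite := by
  induction n with
  | zero =>
    refine (Set.finite_singleton (1 : G)).subset fun g hg => ?_
    exact (wordLength_eq_zero hS).1 (Nat.le_zero.1 hg)
  | succ n ih =>
    refine (ih.union (Set.Finite.image2 (fun a b => a * b) S.finite_toSet ih)).subset ?_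
    intro g hg
    by_cases h : wordLength S g ≤ n
    · exact Or.inl h
    · obtain ⟨a, b, rfl, ha, hb⟩ := exists_mul_wordLength hS 1 n g
        (by simp only [Set.mem_ofPred_eq] at hg; omega)
      exact Or.inr ⟨a, (wordLength_eq_one hS).1 ha, b, hb.le, rfl⟩

/-! ### Connected annuli from one-endedness. -/

/-- Outside every ball of a one-ended group there is a connected set containing all group elements
of large length. -/
theorem exists_connected_cofinite {G : Type*} [Group G] {S : Finset G}
    (hS : IsSymmGeneratingSet S) (h1 : HasNumberOfEnds (rightCayleyGraph S) 1 1) (d : ℕ) :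
    ∃ (K : Set G) (t : ℕ), CayleyConnected S K ∧ (∀ x ∈ K, d < wordLength S x) ∧
      (∀ x, t ≤ wordLength S x → x ∈ K) ∧ ∀ r, ∃ x ∈ K, r < wordLength S x := by
  -- The point `1` is isolated in `ℕ∞`, so convergence means eventual equality.
  have hev : ∀ᶠ n in Filter.atTop, numUnboundedComponents (rightCayleyGraph S) 1 n = 1 :=
    h1.eventually (p := fun k => k = 1) ((ENat.mem_nhds_iff ENat.one_ne_top).2 rfl)
  obtain ⟨n, hn, hdn⟩ := (hev.and (Filter.eventually_ge_atTop d)).exists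
  obtain ⟨C, hC⟩ := Set.encard_eq_one.1 hn
  have hCmem : C ∈ ({C} : Set _) := rfl
  rw [← hC] at hCmem
  have hfin : (graphBall (rightCayleyGraph S) 1 n).Finite :=
    (finite_wordLength_le hS n).subset fun g hg => (mem_graphBall_iff hS n g).1 hg
  have hbdd : ∀ D : (rightCayleyGraph S).ComponentCompl (graphBall (rightCayleyGraph S) 1 n),
      ∃ r, D ≠ C → D.supp ⊆ graphBall (rightCayleyGraph S) 1 r := by
    intro D
    by_contra! h
    have hD : D ∈ ({C} : Set _) := hC ▸ fun r => (h r).2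
    exact (h 0).1 hD
  choose r hr using hbdd
  have hlf : (rightCayleyGraph S).LocallyFinite := fun v => by
    refine Set.Finite.fintype ((S.finite_toSet.image (fun s => s * v)).subset ?_)
    intro w hw
    obtain ⟨s, hs, e⟩ := (rightCayleyGraph_adj hS _ _).1 (SimpleGraph.Adj.symm hw)
    exact ⟨s, hs, e.symm⟩
  have hF : Fact (rightCayleyGraph S).Preconnected := ⟨(rightCayleyGraph_connected hS).preconnected⟩
  -- Only finitely many components are left by the ball, so the bounded ones lie in a common ball of
  -- radius `R`.
  have hcompl : Finite ((rightCayleyGraph S).ComponentCompl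
      (graphBall (rightCayleyGraph S) 1 n)) := by
    have := SimpleGraph.componentCompl_finite (G := rightCayleyGraph S) hfin.toFinset
    rwa [hfin.coe_toFinset] at this
  obtain ⟨R, hR⟩ := (Set.finite_range r).bddAbove
  refine ⟨C.supp, max R n + 1, ?_, ?_, ?_, ?_⟩
  · intro P hP hcl
    have hsub : ∀ x y : G, x ∈ C.supp → x ∈ P → y ∈ C.supp → y ∈ P := by
      intro x y hx hxP hy
      obtain ⟨hxK, hxC⟩ := hx
      obtain ⟨hyK, hyC⟩ := hy
      obtain ⟨w⟩ := SimpleGraph.ConnectedComponent.exact (hxC.trans hyC.symm)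
      have : ∀ (a b : ((graphBall (rightCayleyGraph S) 1 n)ᶜ : Set G)),
          ((rightCayleyGraph S).induce (graphBall (rightCayleyGraph S) 1 n)ᶜ).Walk a b →
          a.1 ∈ C.supp → a.1 ∈ P → b.1 ∈ P := by
        intro a b w
        induction w with
        | nil => exact fun _ h => h
        | @cons a b c hadj _ ih =>
          intro haC haP
          have hab := SimpleGraph.induce_adj.1 hadj
          have hbC : b.1 ∈ C.supp := SimpleGraph.ComponentCompl.mem_of_adj _ _ haC b.2 hab
          obtain ⟨s, hs, e⟩ := (rightCayleyGraph_adj hS _ _).1 hab.symm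
          refine ih hbC (hcl _ haC haP _ hbC ?_)
          rw [e]; simpa using hs
      exact this _ _ w ⟨hxK, hxC⟩ hxP
    obtain ⟨x, hx, hxP⟩ := hP
    exact fun y hy => hsub x y hx hxP hy
  · intro x hx
    have := SimpleGraph.ComponentCompl.notMem_of_mem hx
    rw [mem_graphBall_iff hS] at this
    omega
  · intro x hx
    have hxn : x ∉ graphBall (rightCayleyGraph S) 1 n := by
      rw [mem_graphBall_iff hS]; omega
    refine ⟨hxn, ?_⟩
    by_contra hne
    have := hr _ hne ⟨hxn, rfl⟩
    rw [mem_graphBall_iff hS] at this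
    have := hR (Set.mem_range_self ((rightCayleyGraph S).componentComplMk hxn))
    omega
  · intro r
    obtain ⟨x, hx, hxr⟩ := Set.not_subset.1 (hCmem r)
    rw [mem_graphBall_iff hS] at hxr
    exact ⟨x, hx, by omega⟩

theorem infinite_of_wordLength_unbounded {G : Type*} [Group G] {S : Finset G} {K : Set G}
    (hK : ∀ r, ∃ x ∈ K, r < wordLength S x) : K.Infinite := by
  intro hfin
  obtain ⟨R, hR⟩ := (hfin.image (wordLength S)).bddAbove
  obtain ⟨x, hx, hxR⟩ := hK R
  exact absurd (hR (Set.mem_image_of_mem _ hx)) (by omega)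

/-- A finite subset of a connected set is contained in a finite connected subset. -/
theorem CayleyConnected.exists_finite_superset {G : Type*} [Group G] {S : Finset G}
    (hS : IsSymmGeneratingSet S) {K : Set G} (hK : CayleyConnected S K) {A : Set G}
    (hA : A.Finite) (hAK : A ⊆ K) :
    ∃ H : Set G, H.Finite ∧ CayleyConnected S H ∧ A ⊆ H ∧ H ⊆ K := by
  classical
  rcases A.eq_empty_or_nonempty with rfl | hne
  · exact ⟨∅, Set.finite_empty, fun P _ _ => Set.empty_subset _, subset_rfl, hAK⟩
  have hKc := hK.induce_connected hS (hne.mono hAK)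
  have hA' : {x : K | x.1 ∈ A}.Finite := hA.preimage Subtype.val_injective.injOn
  obtain ⟨a, ha⟩ := hne
  obtain ⟨T, hT, hTc⟩ := SimpleGraph.extend_finset_to_connected hKc.preconnected
    (t := hA'.toFinset) ⟨⟨a, hAK ha⟩, by simpa using ha⟩
  refine ⟨Subtype.val '' (T : Set K), T.finite_toSet.image _, ?_, ?_, ?_⟩
  · refine cayleyConnected_of_reachable hS ?_
    rintro ⟨_, x, hx, rfl⟩ ⟨_, y, hy, rfl⟩
    let f : (((rightCayleyGraph S).induce K).induce (T : Set K)) →g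
        (rightCayleyGraph S).induce (Subtype.val '' (T : Set K)) :=
      ⟨fun z => ⟨z.1.1, z.1, z.2, rfl⟩, fun h => h⟩
    exact (hTc.preconnected ⟨x, hx⟩ ⟨y, hy⟩).map f
  · exact fun x hx => ⟨⟨x, hAK hx⟩, hT (by simpa using hx), rfl⟩
  · rintro _ ⟨x, -, rfl⟩
    exact x.2

/-- In a one-ended group, thick spheres can be joined up inside large annuli. -/
theorem exists_connected_annulus {G : Type*} [Group G] {S : Finset G}
    (hS : IsSymmGeneratingSet S) (h1 : HasNumberOfEnds (rightCayleyGraph S) 1 1) (d : ℕ) :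
    ∃ (t e : ℕ) (H : Set G), d < t ∧ t ≤ e ∧ CayleyConnected S H ∧
      (∀ x ∈ H, d < wordLength S x ∧ wordLength S x ≤ e) ∧
      ∀ x, t ≤ wordLength S x → wordLength S x ≤ t + 3 → x ∈ H := by
  obtain ⟨K, t, hK, hKd, hKt, -⟩ := exists_connected_cofinite hS h1 d
  obtain ⟨H, hHf, hH, hAH, hHK⟩ := hK.exists_finite_superset hS
    (A := {x | max t (d + 1) ≤ wordLength S x ∧ wordLength S x ≤ max t (d + 1) + 3})
    ((finite_wordLength_le hS _).subset fun x hx => hx.2) fun x hx => hKt x (by have := hx.1; omega)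
  obtain ⟨R, hR⟩ := (hHf.image (wordLength S)).bddAbove
  refine ⟨max t (d + 1), max R (max t (d + 1)), H, by omega, by omega, hH, ?_, ?_⟩
  · exact fun x hx => ⟨hKd x (hHK hx), le_max_of_le_left (hR (Set.mem_image_of_mem _ hx))⟩
  · exact fun x h h' => hAH ⟨h, h'⟩

/-! ### Boundaries of infinite connected sets. -/

/-- The vertices of `C` adjacent to the complement of `C`. -/
def innerBoundary {G : Type*} [Group G] (S : Finset G) (C : Set G) : Set G :=
  {x | x ∈ C ∧ ∃ y, y ∉ C ∧ y * x⁻¹ ∈ S}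

/-- In a one-ended group, an infinite connected set avoiding a large ball has a large boundary. -/
theorem exists_le_card_innerBoundary {G : Type*} [Group G] {S : Finset G}
    (hS : IsSymmGeneratingSet S) (h1 : HasNumberOfEnds (rightCayleyGraph S) 1 1) (m : ℕ) :
    ∃ n, ∀ C : Set G, CayleyConnected S C → C.Infinite → (∀ x ∈ C, n < wordLength S x) →
      ∀ X : Finset G, innerBoundary S C ⊆ X → m ≤ X.card := by
  classical
  choose t e H hdt hte hH hHd hHt using exists_connected_annulus hS h1
  -- These radii make the annuli `H (r i)` pairwise disjoint. Translated to be centred at a boundary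
  -- point `p` nearest to `1`, each one will contain a boundary point of `C`.
  let r : ℕ → ℕ := fun i => e^[i] 0
  have hr : ∀ i, r (i + 1) = e (r i) := fun i => Function.iterate_succ_apply' e i 0
  have hmono : StrictMono r := strictMono_nat_of_lt_succ fun i => by
    rw [hr]; exact (hdt _).trans_le (hte _)
  refine ⟨r m, fun C hC hinf hCn X hX => ?_⟩
  have h1C : (1 : G) ∉ C := fun h => by
    have := hCn 1 h
    rw [wordLength_one] at this
    omega
  obtain ⟨c, hc⟩ := hinf.nonempty
  obtain ⟨b, -, hbC, y, -, hyC, hby⟩ :=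
    (cayleyConnected_univ hS).exists_crossing (Set.mem_univ c) hc (Set.mem_univ 1) h1C
  have hne : (innerBoundary S C).Nonempty := ⟨b, hbC, y, hyC, hby⟩
  obtain ⟨p, hp, hpmin⟩ : ∃ p ∈ innerBoundary S C, ∀ q ∈ innerBoundary S C,
      wordLength S p ≤ wordLength S q :=
    ⟨Function.argminOn (wordLength S) _ hne, Function.argminOn_mem _ _ hne,
      fun q hq => Function.argminOn_le _ _ hq⟩
  have hbelow : ∀ n x, wordLength S x = n → n < wordLength S p → x ∉ C := by
    intro n
    induction n with
    | zero => intro x hx _; rwa [(wordLength_eq_zero hS).1 hx]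
    | succ n ih =>
      intro x hx hlt hxC
      obtain ⟨a, b, rfl, ha, hb⟩ := exists_mul_wordLength hS 1 n x (by omega)
      have := hpmin (a * b) ⟨hxC, b, ih b hb (by omega),
        (wordLength_eq_one hS).1 (by rw [← wordLength_inv hS]; simpa using ha)⟩
      omega
  have hex : ∀ i : Fin m, ∃ x ∈ innerBoundary S C, r i < wordLength S (x * p⁻¹) ∧
      wordLength S (x * p⁻¹) ≤ r (i + 1) := by
    intro i
    have hpn := hCn p hp.1
    have him : r (i + 1) ≤ r m := hmono.monotone i.2
    have htr : t (r i) ≤ r (i + 1) := by rw [hr]; exact hte _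
    -- `C` is infinite and connected, so it leaves `p` through every sphere.
    obtain ⟨v, hvC, hv⟩ : ∃ v ∈ C, wordLength S (v * p⁻¹) = t (r i) := by
      obtain ⟨q, hqC, hq⟩ : ∃ q ∈ C, ¬ wordLength S (q * p⁻¹) < t (r i) := by
        by_contra! h
        refine hinf (((finite_wordLength_le hS (t (r i))).image (fun x => x * p)).subset ?_)
        exact fun x hx => ⟨x * p⁻¹, (h x hx).le, by simp⟩
      obtain ⟨x, hxC, hx, y, hyC, hy, hs⟩ := hC.exists_crossing
        (P := {x | wordLength S (x * p⁻¹) < t (r i)}) hp.1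
        (by simpa [wordLength_one] using (hdt (r i)).pos) hqC hq
      have := wordLength_le_of_mem hS (x := x * p⁻¹) (y := y * p⁻¹) (by simpa using hs)
      simp only [Set.mem_ofPred_eq] at hx hy
      exact ⟨y, hyC, by omega⟩
    -- Going from `p` towards `1` along a geodesic leaves `C`, since nothing shorter than `p` lies
    -- in `C`. The annulus thus contains both `v ∈ C` and `u ∉ C`.
    obtain ⟨a, u, hau, ha, hu⟩ := exists_mul_wordLength hS (t (r i))
      (wordLength S p - t (r i)) p (by omega)
    have huC : u ∉ C := hbelow _ u rfl (by have := hdt (r i); omega)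
    have hup : wordLength S (u * p⁻¹) = t (r i) := by
      rw [wordLength_sub_comm hS, hau]
      simpa using ha
    obtain ⟨x, hxH, hxC, y, -, hyC, hs⟩ := ((hH (r i)).mul_right p).exists_crossing
      (hHt (r i) (v * p⁻¹) hv.ge (by omega)) hvC (hHt (r i) (u * p⁻¹) hup.ge (by omega)) huC
    have := hHd (r i) _ hxH
    exact ⟨x, ⟨hxC, y, hyC, hs⟩, this.1, by rw [hr]; exact this.2⟩
  choose x hxb hx1 hx2 using hex
  have hlt : ∀ i j : Fin m, x i = x j → ¬ i < j := by
    intro i j hij hlt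
    have h1 := hx2 i
    have h2 := hx1 j
    have h3 : r (i + 1) ≤ r j := hmono.monotone hlt
    rw [hij] at h1
    omega
  have hinj : Function.Injective x := fun i j hij =>
    le_antisymm (not_lt.1 (hlt j i hij.symm)) (not_lt.1 (hlt i j hij))
  have := Finset.card_le_card_of_injOn (s := Finset.univ) (t := X) x
    (fun i _ => hX (hxb i)) hinj.injOn
  simpa using this

/-! ### Disjoint rays in a net. -/

/-- A Menger type theorem: under an isoperimetric condition, there are `k` disjoint rays that start
in the finite set `D` and move along `nbhd`. -/
theorem exists_disjoint_rays {V : Type*} [DecidableEq V] (nbhd : V → Finset V)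
    (hself : ∀ x, x ∈ nbhd x) (D : Finset V) (k : ℕ)
    (h : ∀ T : Finset V, k + T.card ≤ (D ∪ T.biUnion nbhd).card) :
    ∃ ρ : Fin k → ℕ → V, (∀ i, ρ i 0 ∈ D) ∧ (∀ i a, ρ i (a + 1) ∈ nbhd (ρ i a)) ∧
      ∀ i j a b, ρ i a = ρ j b → i = j ∧ a = b := by
  classical
  -- Hall's theorem is applied to `k` copies of `D` and all the sets `nbhd x`. The resulting
  -- injection gives every vertex a successor; successors are distinct and avoid the `k` starting
  -- points, so the orbits are disjoint and never repeat.
  let t : Fin k ⊕ V → Finset V := Sum.elim (fun _ => D) nbhd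
  obtain ⟨f, hf, hft⟩ := (Finset.all_card_le_biUnion_card_iff_exists_injective t).1 (by
    intro s
    have hs : s.card = s.toLeft.card + s.toRight.card := Finset.card_toLeft_add_card_toRight.symm
    have hR : s.toRight.biUnion nbhd ⊆ s.biUnion t := by
      refine Finset.biUnion_subset.2 fun x hx => ?_
      exact Finset.subset_biUnion_of_mem t (Finset.mem_toRight.1 hx)
    rcases s.toLeft.eq_empty_or_nonempty with he | ⟨i, hi⟩
    · rw [hs, he, Finset.card_empty, zero_add]
      refine (Finset.card_le_card fun x hx => ?_).trans (Finset.card_le_card hR)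
      exact Finset.mem_biUnion.2 ⟨x, hx, hself x⟩
    · have hL : D ⊆ s.biUnion t := Finset.subset_biUnion_of_mem t (Finset.mem_toLeft.1 hi)
      have h1 : s.toLeft.card ≤ k := by simpa using Finset.card_le_univ s.toLeft
      have h2 := h s.toRight
      have h3 := Finset.card_le_card (Finset.union_subset hL hR)
      omega)
  let ρ : Fin k → ℕ → V := fun i a => Nat.rec (f (Sum.inl i)) (fun _ x => f (Sum.inr x)) a
  refine ⟨ρ, fun i => hft (Sum.inl i), fun i a => hft (Sum.inr (ρ i a)), ?_⟩
  intro i j a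
  induction a with
  | zero =>
    rintro (_ | b) hab
    · exact ⟨Sum.inl_injective (hf hab), rfl⟩
    · exact absurd (hf (a₁ := Sum.inl i) (a₂ := Sum.inr (ρ j b)) hab) (by simp)
  | succ a ih =>
    rintro (_ | b) hab
    · exact absurd (hf (a₁ := Sum.inr (ρ i a)) (a₂ := Sum.inl j) hab) (by simp)
    · obtain ⟨h1, h2⟩ := ih b (Sum.inr_injective (hf (a₁ := Sum.inr (ρ i a)) hab))
      exact ⟨h1, by rw [h2]⟩

/-- A maximal set disjoint from its translate by `s`. -/
theorem exists_maximal_disjoint_translate {G : Type*} [Group G] (s : G) (hs : s ≠ 1) :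
    ∃ N : Set G, (∀ x ∈ N, s * x ∉ N) ∧ ∀ g, g ∈ N ∨ s * g ∈ N ∨ s⁻¹ * g ∈ N := by
  obtain ⟨N, hN⟩ := zorn_subset {N : Set G | ∀ x ∈ N, s * x ∉ N} (by
    intro c hc hchain
    refine ⟨⋃₀ c, ?_, fun A hA => Set.subset_sUnion_of_mem hA⟩
    rintro x ⟨A, hA, hx⟩ ⟨B, hB, hsx⟩
    rcases hchain.total hA hB with h | h
    · exact hc hB x (h hx) hsx
    · exact hc hA x hx (h hsx))
  refine ⟨N, hN.prop, fun g => ?_⟩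
  by_contra! h
  obtain ⟨h1, h2, h3⟩ := h
  -- Otherwise `g` could be added to `N`; `s ≠ 1` excludes `s * g = g`.
  refine h1 (hN.le_of_ge (y := insert g N) ?_ (Set.subset_insert g N) (Set.mem_insert g N))
  rintro x (rfl | hx) (h | h)
  · exact hs (by simpa using h)
  · exact h2 h
  · exact h3 (by rw [← h]; simpa using hx)
  · exact hN.prop x hx h

/-- In a one-ended group, a finite set has an infinite complementary component containing all but
a bounded set. -/
theorem exists_infinite_component {G : Type*} [Group G] {S : Finset G}
    (hS : IsSymmGeneratingSet S) (h1 : HasNumberOfEnds (rightCayleyGraph S) 1 1) {F : Set G}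
    (hF : F.Finite) :
    ∃ C : Set G, CayleyConnected S C ∧ C.Infinite ∧ (∀ x ∈ C, x ∉ F) ∧
      ∀ x ∈ C, ∀ y, y ∉ C → y * x⁻¹ ∈ S → y ∈ F := by
  obtain ⟨d, hd⟩ := (hF.image (wordLength S)).bddAbove
  obtain ⟨K, t, hK, hKd, hKt, hKu⟩ := exists_connected_cofinite hS h1 d
  have hKF : ∀ x ∈ K, x ∉ F := fun x hx hxF =>
    absurd (hd (Set.mem_image_of_mem _ hxF)) (by have := hKd x hx; omega)
  obtain ⟨z, hz, -⟩ := hKu 0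
  -- The component of the complement of `F` that contains `K`.
  refine ⟨⋃₀ {L | CayleyConnected S L ∧ K ⊆ L ∧ ∀ x ∈ L, x ∉ F}, ?_, ?_, ?_, ?_⟩
  · rintro P ⟨x, ⟨L, hL, hxL⟩, hxP⟩ hP
    have key : ∀ L', L' ∈ {L | CayleyConnected S L ∧ K ⊆ L ∧ ∀ x ∈ L, x ∉ F} →
        ∀ w ∈ L', w ∈ P → L' ⊆ P := fun L' hL' w hw hwP => hL'.1 P ⟨w, hw, hwP⟩
      fun a ha haP b hb => hP a ⟨L', hL', ha⟩ haP b ⟨L', hL', hb⟩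
    have hzP : z ∈ P := key L hL x hxL hxP (hL.2.1 hz)
    rintro y ⟨L', hL', hy⟩
    exact key L' hL' z (hL'.2.1 hz) hzP hy
  · exact (infinite_of_wordLength_unbounded hKu).mono
      (Set.subset_sUnion_of_mem ⟨hK, subset_rfl, hKF⟩)
  · rintro x ⟨L, hL, hx⟩
    exact hL.2.2 x hx
  · rintro x ⟨L, hL, hx⟩ y hy hs
    by_contra hyF
    refine hy ⟨L ∪ {y}, ⟨?_, hL.2.1.trans Set.subset_union_left, ?_⟩, Or.inr rfl⟩
    · refine hL.1.union hS (B := {y}) ?_ hx rfl hs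
      rintro P ⟨w, hw, hwP⟩ -
      rw [Set.mem_singleton_iff.1 hw] at hwP
      simpa using hwP
    · rintro w (hw | rfl)
      · exact hL.2.2 w hw
      · exact hyF

/-- In a one-ended group, every net contains arbitrarily many disjoint rays with steps of length at
most `3`. -/
theorem exists_disjoint_rays_of_net {G : Type*} [Group G] {S : Finset G}
    (hS : IsSymmGeneratingSet S) (h1 : HasNumberOfEnds (rightCayleyGraph S) 1 1) {N : Set G}
    (π : G → G) (hπN : ∀ g, π g ∈ N) (hπ : ∀ g, wordLength S (π g * g⁻¹) ≤ 1) (k : ℕ) :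
    ∃ (n : ℕ) (ρ : Fin k → ℕ → G), (∀ i, wordLength S (ρ i 0) ≤ n) ∧ (∀ i a, ρ i a ∈ N) ∧
      (∀ i a, wordLength S (ρ i (a + 1) * (ρ i a)⁻¹) ≤ 3) ∧
      ∀ i j a b, ρ i a = ρ j b → i = j ∧ a = b := by
  classical
  have hfin : ∀ (r : ℕ) (x : G), {y : N | wordLength S (y.1 * x⁻¹) ≤ r}.Finite := fun r x =>
    (finite_wordLength_le hS r).preimage
      (f := fun y : N => y.1 * x⁻¹) (fun a _ b _ hab => Subtype.ext (mul_right_cancel hab))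
  let E : Finset G := (finite_wordLength_le hS 1).toFinset
  obtain ⟨n, hn⟩ := exists_le_card_innerBoundary hS h1 (E.card * k)
  obtain ⟨ρ, h0, hstep, hinj⟩ := exists_disjoint_rays
    (fun x : N => (hfin 3 x).toFinset) (fun x => by simp [wordLength_one])
    (hfin (n + 2) 1).toFinset k (by
      intro T
      set U := (hfin (n + 2) 1).toFinset ∪ T.biUnion (fun x : N => (hfin 3 x).toFinset) with hU
      have hTU : T ⊆ U := fun x hx => Finset.mem_union_right _
        (Finset.mem_biUnion.2 ⟨x, hx, by simp [wordLength_one]⟩)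
      suffices k ≤ (U \ T).card by
        rw [Finset.card_sdiff_of_subset hTU] at this
        have := Finset.card_le_card hTU
        omega
      -- With `C` an infinite component outside `F`, `π` sends its inner boundary into `U \ T`: a
      -- neighbour in `F` puts `π x` within `n + 2` of `1` or within `1 + 1 + 1` of `T`, while `x ∉
      -- F` forces `π x ∉ T`. Fibres have at most `E.card` elements.
      let F : Set G := {g | wordLength S g ≤ n} ∪ ⋃ x ∈ T, {g | wordLength S (g * x.1⁻¹) ≤ 1}
      have hF : F.Finite := by
        refine (finite_wordLength_le hS n).union (T.finite_toSet.biUnion fun x _ => ?_)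
        exact (finite_wordLength_le hS 1).preimage (f := fun g => g * x.1⁻¹)
          (mul_left_injective _).injOn
      obtain ⟨C, hC, hCinf, hCF, hCadj⟩ := exists_infinite_component hS h1 hF
      have hcov : innerBoundary S C ⊆
          ((E ×ˢ (U \ T)).image fun q => q.1 * q.2.1 : Finset G) := by
        rintro x ⟨hxC, y, hyC, hyx⟩
        have hxF := hCF x hxC
        simp only [F, Set.mem_union, Set.mem_iUnion, Set.mem_ofPred_eq, not_or, not_exists] at hxF
        have hyx1 := (wordLength_eq_one hS).2 hyx
        have hpx := hπ x
        have hxp := wordLength_sub_comm hS x (π x)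
        simp only [Finset.coe_image, Set.mem_image, Finset.mem_coe, Finset.mem_product,
          Finset.mem_sdiff]
        refine ⟨(x * (π x)⁻¹, ⟨π x, hπN x⟩), ⟨?_, ?_, ?_⟩, by simp⟩
        · simpa [E, ← hxp] using hpx
        · have htri := wordLength_sub_triangle hS y x (π x)
          have hxy := wordLength_sub_comm hS x y
          rcases hCadj x hxC y hyC hyx with hy | hy
          · refine Finset.mem_union_left _ ?_
            have := wordLength_le_add_sub hS y (π x)
            simp only [Set.mem_ofPred_eq] at hy
            simp only [Set.Finite.mem_toFinset, Set.mem_ofPred_eq, inv_one, mul_one]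
            omega
          · simp only [Set.mem_iUnion, Set.mem_ofPred_eq] at hy
            obtain ⟨z, hz, hyz⟩ := hy
            refine Finset.mem_union_right _ (Finset.mem_biUnion.2 ⟨z, hz, ?_⟩)
            have := wordLength_sub_triangle hS z.1 y (π x)
            simp only [Set.Finite.mem_toFinset, Set.mem_ofPred_eq]
            omega
        · intro hT
          exact hxF.2 _ hT (by simpa [← hxp] using hpx)
      have hle := hn C hC hCinf (fun x hx => by
        have := hCF x hx
        simp only [F, Set.mem_union, Set.mem_ofPred_eq, not_or] at this
        omega) _ hcov
      have := hle.trans Finset.card_image_le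
      rw [Finset.card_product] at this
      exact Nat.le_of_mul_le_mul_left this
        (Finset.card_pos.2 ⟨1, by simp [E, wordLength_one]⟩))
  refine ⟨n + 2, fun i a => (ρ i a).1, fun i => ?_, fun i a => (ρ i a).2, fun i a => ?_, ?_⟩
  · simpa using h0 i
  · simpa using hstep i a
  · exact fun i j a b hab => hinj i j a b (Subtype.ext hab)

/-- A ray passes through the thick sphere at every radius beyond its starting point. -/
theorem exists_ray_crossing {G : Type*} [Group G] {S : Finset G}
    (hS : IsSymmGeneratingSet S) (ρ : ℕ → G) (hinj : Function.Injective ρ)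
    (hstep : ∀ a, wordLength S (ρ (a + 1) * (ρ a)⁻¹) ≤ 3) {t : ℕ} (h0 : wordLength S (ρ 0) < t) :
    ∃ a, t ≤ wordLength S (ρ a) ∧ wordLength S (ρ a) ≤ t + 3 := by
  classical
  have hex : ∃ a, t ≤ wordLength S (ρ a) := by
    by_contra! h
    refine Set.infinite_range_of_injective hinj ((finite_wordLength_le hS t).subset ?_)
    rintro _ ⟨a, rfl⟩
    exact (h a).le
  refine ⟨Nat.find hex, Nat.find_spec hex, ?_⟩
  obtain ⟨b, hb⟩ : ∃ b, Nat.find hex = b + 1 := Nat.exists_eq_succ_of_ne_zero fun h => by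
    have := Nat.find_spec hex
    rw [h] at this
    omega
  have h1 := Nat.find_min hex (m := b) (by omega)
  have h2 := wordLength_le_add_sub hS (ρ b) (ρ (b + 1))
  have h3 := hstep b
  rw [hb]
  omega

/-! ### Assembling the complete minor. -/

theorem isSymmGeneratingSet_ball {G : Type*} [Group G] {S : Finset G}
    (hS : IsSymmGeneratingSet S) {r : ℕ} (hr : 1 ≤ r) {S' : Finset G}
    (hS' : ∀ g, g ∈ S' ↔ g ≠ 1 ∧ wordLength S g ≤ r) : IsSymmGeneratingSet S' where
  closure_eq_top := by
    refine top_le_iff.1 (hS.closure_eq_top ▸ Subgroup.closure_mono fun s hs => ?_)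
    have h := (wordLength_eq_one hS).2 hs
    exact (hS' s).2 ⟨fun h1 => hS.one_notMem (h1 ▸ hs), h.le.trans hr⟩
  one_notMem h := ((hS' 1).1 h).1 rfl
  inv_mem s hs := by
    rw [hS', wordLength_inv hS] at *
    exact ⟨inv_ne_one.2 hs.1, hs.2⟩

theorem isGraphMinor_completeGraph {G : Type*} [Group G] {S : Finset G}
    (hS : IsSymmGeneratingSet S) {m : ℕ} (B : Fin m → Set G) (hne : ∀ i, (B i).Nonempty)
    (hfin : ∀ i, (B i).Finite) (hconn : ∀ i, CayleyConnected S (B i))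
    (hdisj : ∀ i j, i ≠ j → Disjoint (B i) (B j))
    (hadj : ∀ i j, i ≠ j → ∃ u ∈ B i, ∃ v ∈ B j, v * u⁻¹ ∈ S) :
    IsGraphMinor (SimpleGraph.completeGraph (Fin m)) (rightCayleyGraph S) := by
  refine ⟨fun i => (⊤ : (rightCayleyGraph S).Subgraph).induce (B i), fun i => ⟨hfin i, ?_⟩,
    hdisj, fun i j hij => ?_⟩
  · exact SimpleGraph.connected_induce_iff.1 ((hconn i).induce_connected hS (hne i))
  · obtain ⟨u, hu, v, hv, h⟩ := hadj i j hij
    exact ⟨u, hu, v, hv, ((rightCayleyGraph_adj hS v u).2 ⟨_, h, by simp⟩).symm⟩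

theorem isGraphMinor_completeGraph_of_oneEnded {G : Type*} [Group G] {S : Finset G}
    (hS : IsSymmGeneratingSet S) (h1 : HasNumberOfEnds (rightCayleyGraph S) 1 1) {S' : Finset G}
    (hS' : ∀ g, g ∈ S' ↔ g ≠ 1 ∧ wordLength S g ≤ 5) (m : ℕ) :
    IsGraphMinor (SimpleGraph.completeGraph (Fin m)) (rightCayleyGraph S') := by
  classical
  have hSS' := isSymmGeneratingSet_ball hS (by norm_num) hS'
  obtain ⟨s, hs⟩ : ∃ s, s ∈ S := by
    obtain ⟨K, t, -, -, -, hK⟩ := exists_connected_cofinite hS h1 0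
    obtain ⟨x, -, hx⟩ := hK 0
    obtain ⟨a, b, -, ha, -⟩ := exists_mul_wordLength hS 1 (wordLength S x - 1) x (by omega)
    exact ⟨a, (wordLength_eq_one hS).1 ha⟩
  have hs1 := (wordLength_eq_one hS).2 hs
  obtain ⟨N, hN, hNnet⟩ := exists_maximal_disjoint_translate s
    fun h => hS.one_notMem (h ▸ hs)
  have hnet : ∀ g, ∃ x ∈ N, wordLength S (x * g⁻¹) ≤ 1 := by
    intro g
    rcases hNnet g with h | h | h
    · exact ⟨g, h, by simp [wordLength_one]⟩
    · exact ⟨_, h, by simp [hs1]⟩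
    · exact ⟨_, h, by simp [wordLength_inv hS, hs1]⟩
  choose π hπN hπ using hnet
  obtain ⟨n, ρ, hρ0, hρN, hρstep, hρinj⟩ := exists_disjoint_rays_of_net hS h1 π hπN hπ m
  -- the copy of `v` in the translate `s * N`
  let τ : G → G := fun v => s * π v
  have hτN : ∀ v, τ v ∉ N := fun v => hN _ (hπN v)
  have hτ : ∀ v, wordLength S (τ v * v⁻¹) ≤ 2 := fun v => by
    have := wordLength_mul_le hS s (π v * v⁻¹)
    have := hπ v
    simp only [τ, mul_assoc] at *
    omega
  choose t e H hdt hte hH hHd hHt using exists_connected_annulus hS h1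
  -- Since `τ` moves points by at most 2, a gap of 4 keeps the images of different annuli disjoint.
  -- Starting at `n` puts all ray origins inside every annulus.
  let d : ℕ → ℕ := fun i => (fun x => e x + 4)^[i] n
  have hd : ∀ i, d (i + 1) = e (d i) + 4 := fun i => Function.iterate_succ_apply' _ i n
  have hmono : StrictMono d := strictMono_nat_of_lt_succ fun i => by
    have := hdt (d i)
    have := hte (d i)
    rw [hd]
    omega
  have hcross : ∀ i j : Fin m, ∃ a, ρ i a ∈ H (d j) := by
    intro i j
    have hnd : n ≤ d j := hmono.monotone (Nat.zero_le j)
    have h0 := hρ0 i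
    have htj := hdt (d j)
    obtain ⟨a, ha, ha'⟩ := exists_ray_crossing hS (ρ i)
      (fun a b hab => (hρinj i i a b hab).2) (hρstep i) (t := t (d j)) (by omega)
    exact ⟨a, hHt _ _ ha ha'⟩
  choose a ha using hcross
  obtain ⟨M, hM⟩ := (Set.finite_range fun q : Fin m × Fin m => a q.1 q.2).bddAbove
  have haM : ∀ i j, a i j ≤ M := fun i j => hM ⟨(i, j), rfl⟩
  have hlink : ∀ i j, τ (ρ i (a i j)) * (ρ i (a i j))⁻¹ ∈ S' := fun i j => by
    refine (hS' _).2 ⟨fun h => ?_, (hτ _).trans (by norm_num)⟩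
    have hN' := hτN (ρ i (a i j))
    rw [mul_inv_eq_one.1 h] at hN'
    exact hN' (hρN i (a i j))
  have hray : ∀ i b, CayleyConnected S' (ρ i '' Set.Iic b) := by
    intro i b
    induction b with
    | zero =>
      rintro P ⟨_, ⟨x, hx, rfl⟩, hxP⟩ - _ ⟨y, hy, rfl⟩
      rw [Set.mem_Iic, Nat.le_zero] at hx hy
      rwa [hy, ← hx]
    | succ b ih =>
      have e : ρ i '' Set.Iic (b + 1) = ρ i '' Set.Iic b ∪ {ρ i (b + 1)} := by
        rw [← Set.image_singleton, ← Set.image_union]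
        congr 1
        ext x
        simp only [Set.mem_Iic, Set.mem_union, Set.mem_singleton_iff]
        omega
      rw [e]
      refine ih.union hSS' (B := {ρ i (b + 1)}) ?_ ⟨b, Set.mem_Iic.2 le_rfl, rfl⟩ rfl ?_
      · rintro P ⟨w, hw, hwP⟩ -
        rw [Set.mem_singleton_iff.1 hw] at hwP
        simpa using hwP
      · refine (hS' _).2 ⟨fun h => ?_, (hρstep i b).trans (by norm_num)⟩
        have := (hρinj i i _ _ (mul_inv_eq_one.1 h)).2
        omega
  have hτH : ∀ j : Fin m, CayleyConnected S' (τ '' H (d j)) := by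
    rintro j P ⟨_, ⟨x, hx, rfl⟩, hxP⟩ hP
    have := hH (d j) (τ ⁻¹' P) ⟨x, hx, hxP⟩ ?_
    · exact Set.image_subset_iff.2 this
    intro x hx hxP y hy hs
    rw [Set.mem_preimage] at *
    -- `τ` may identify neighbours; otherwise their images are within `2 + 1 + 2 = 5`, the radius
    -- defining `S'`.
    by_cases hxy : τ y = τ x
    · rwa [hxy]
    refine hP _ ⟨x, hx, rfl⟩ hxP _ ⟨y, hy, rfl⟩ ((hS' _).2 ⟨?_, ?_⟩)
    · exact fun h => hxy (mul_inv_eq_one.1 h)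
    · have h1 := hτ x
      have h2 := hτ y
      have h3 := (wordLength_eq_one hS).2 hs
      have h4 := wordLength_sub_triangle hS (τ x) x (τ y)
      have h5 := wordLength_sub_triangle hS x y (τ y)
      have h6 := wordLength_sub_comm hS x (τ x)
      omega
  refine isGraphMinor_completeGraph hSS' (fun i => ρ i '' Set.Iic M ∪ τ '' H (d i))
    (fun i => ⟨_, Or.inl ⟨0, Nat.zero_le M, rfl⟩⟩) (fun i => ?_) (fun i => ?_) ?_ ?_
  · refine ((Set.finite_Iic M).image _).union (Set.Finite.image _ ?_)
    exact (finite_wordLength_le hS _).subset fun x hx => (hHd _ x hx).2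
  · exact (hray i M).union hSS' (hτH i) ⟨a i i, haM i i, rfl⟩ ⟨_, ha i i, rfl⟩ (hlink i i)
  · have hlt : ∀ (i j : Fin m) x y, x ∈ H (d i) → y ∈ H (d j) → τ x = τ y → ¬ i < j := by
      intro i j x y hx hy hxy hij
      have h1 : d (i + 1) ≤ d j := hmono.monotone hij
      rw [hd] at h1
      have h2 := (hHd _ x hx).2
      have h3 := (hHd _ y hy).1
      have h4 := hτ x
      have h5 := hτ y
      have h6 := wordLength_sub_comm hS y (τ y)
      have h7 := wordLength_le_add_sub hS x (τ x)
      have h8 := wordLength_le_add_sub hS (τ y) y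
      rw [← hxy] at h5 h6 h8
      omega
    intro i j hij
    rw [Set.disjoint_left]
    rintro z (⟨b, -, rfl⟩ | ⟨x, hx, rfl⟩) (⟨c, -, hc⟩ | ⟨y, hy, hyz⟩)
    · exact hij (hρinj _ _ _ _ hc).1.symm
    · exact hτN y (hyz ▸ hρN i b)
    · exact hτN x (hc ▸ hρN j c)
    · rcases lt_or_gt_of_ne hij with h | h
      · exact hlt i j x y hx hy hyz.symm h
      · exact hlt j i y x hy hx hyz h
  · intro i j _
    exact ⟨_, Or.inl ⟨a i j, haM i j, rfl⟩, _, Or.inr ⟨_, ha i j, rfl⟩, hlink i j⟩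

theorem theorem3p7 {G : Type*} [Group G] [Group.FG G] (hG : IsOneEndedGroup G) :
    ∃ S : Finset G, IsSymmGeneratingSet S ∧ ¬ MinorExcluded (rightCayleyGraph S) := by
  obtain ⟨S, hS, h1⟩ := hG
  have hfin : {g : G | g ≠ 1 ∧ wordLength S g ≤ 5}.Finite :=
    (finite_wordLength_le hS 5).subset fun g hg => hg.2
  have hmem : ∀ g, g ∈ hfin.toFinset ↔ g ≠ 1 ∧ wordLength S g ≤ 5 := fun g => by simp
  refine ⟨hfin.toFinset, isSymmGeneratingSet_ball hS (by norm_num) hmem, ?_⟩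
  rintro ⟨m, hm⟩
  exact hm (isGraphMinor_completeGraph_of_oneEnded hS h1 hmem m)
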